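/- Let $H$ be a separable infinite-dimensional complex Hilbert space, let $\{e_{i,j}\}_{i,j=1}^\infty$ be a system of matrix units in $B(H)$ (that is, $e_{i,j}^*=e_{j,i}$, $e_{i,j}e_{j,l}=e_{i,l}$, and $e_{i,j}e_{k,l}=0$ for $j\neq k$) such that $\{e_{i,i}\}_{i=1}^\infty$ is a maximal family of pairwise orthogonal minimal projections of $B(H)$. Let $B_{sk}(H)=\{a\in B(H): a^*=-a\}$, a real Lie algebra with $[a,b]=ab-ba$. For an arbitrary set $\Omega$ let $F(\Omega,B_{sk}(H))$ be the real Lie algebra of all maps $\Omega\to B_{sk}(H)$ with the pointwise operations and bracket. Write $\hat e_{i,j}$ for the constant map on $\Omega$ with value $e_{i,j}$, put $s_{i,j}=\hat e_{i,j}-\hat e_{j,i}$ for $i\neq j$, and let $I$ be the imaginary unit. Let $(\lambda_n)$ be a sequence of nonzero complex numbers with $\sum_{n=1}^\infty|\lambda_n|^2<\infty$ such that $x_o=\sum_{n=1}^\infty\lambda_n s_{n,n+1}$ belongs to $F(\Omega,B_{sk}(H))$. Let $\mathcal L$ be a real Lie subalgebra of $F(\Omega,B_{sk}(H))$ containing $x_o$,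 all the elements $I\hat e_{i,i}$ $(i\ge 1)$ and all the elements $s_{i,j}$ $(i\neq j)$. Let $\Delta:\mathcal L\to\mathcal L$ be a map, not assumed additive or linear, which is a 2-local spatial derivation implemented by elements of $F(\Omega,B_{sk}(H))$, that is: for all $x,y\in\mathcal L$ there is a derivation $D$ of the Lie algebra $\mathcal L$ with $\Delta(x)=D(x)$ and $\Delta(y)=D(y)$, and for all $x,y\in\mathcal L$ there is $a\in F(\Omega,B_{sk}(H))$ with $\Delta(x)=[a,x]$ and $\Delta(y)=[a,y]$. Then $\Delta$ is a spatial derivation: $\Delta$ is a derivation of $\mathcal L$, and there is one element $\bar a\in F(\Omega,B_{sk}(H))$ such that $\Delta(x)=[\bar a,x]$ for all $x\in\mathcal L$. -/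

import Mathlib

noncomputable section

attribute [local instance] LieRing.ofAssociativeRing

/-- The real Lie algebra of skew-adjoint bounded operators on `H`, with bracket `ab - ba`. -/
def Bsk (H : Type*) [NormedAddCommGroup H] [InnerProductSpace ℂ H] [CompleteSpace H] :
    LieSubalgebra ℝ (H →L[ℂ] H) where
  carrier := {a | star a = -a}
  add_mem' := by
    intro a b ha hb
    simp only [Set.mem_ofPred_eq] at ha hb ⊢
    rw [star_add, ha, hb, neg_add]
  zero_mem' := by simp
  smul_mem' := by
    intro c a ha
    simp only [Set.mem_ofPred_eq] at ha ⊢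
    rw [star_smul, ha, smul_neg, star_trivial]
  lie_mem' := by
    intro a b ha hb
    simp only [Set.mem_ofPred_eq] at ha hb ⊢
    rw [Ring.lie_def, star_sub, star_mul, star_mul, ha, hb, neg_mul_neg, neg_mul_neg, neg_sub]

/-- `FunBsk Ω H` is the set of all maps from `Ω` to `Bsk H`. -/
abbrev FunBsk (Ω H : Type*) [NormedAddCommGroup H] [InnerProductSpace ℂ H] [CompleteSpace H] : Type _ :=
  Ω → Bsk H

/-- The pointwise Lie bracket on `FunBsk Ω H`. -/
instance FunBsk.instLieRing (Ω H : Type*) [NormedAddCommGroup H] [InnerProductSpace ℂ H]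
    [CompleteSpace H] : LieRing (FunBsk Ω H) where
  bracket a b := fun t => ⁅a t, b t⁆
  add_lie a b c := funext fun t => add_lie (a t) (b t) (c t)
  lie_add a b c := funext fun t => lie_add (a t) (b t) (c t)
  lie_self a := funext fun t => lie_self (a t)
  leibniz_lie a b c := funext fun t => leibniz_lie (a t) (b t) (c t)

instance FunBsk.instLieAlgebra (Ω H : Type*) [NormedAddCommGroup H] [InnerProductSpace ℂ H]
    [CompleteSpace H] : LieAlgebra ℝ (FunBsk Ω H) where
  lie_smul r a b := funext fun t => lie_smul r (a t) (b t)

/-- `p` is a minimal (orthogonal) projection in `B(H)`: it is nonzero and has no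
subprojections besides `0` and itself (`q * p = q` says `q ≤ p`). -/
def IsMinimalProjection {H : Type*} [NormedAddCommGroup H] [InnerProductSpace ℂ H]
    [CompleteSpace H] (p : H →L[ℂ] H) : Prop :=
  IsStarProjection p ∧ p ≠ 0 ∧
    ∀ q : H →L[ℂ] H, IsStarProjection q → q * p = q → q = 0 ∨ q = p

/-- A system of matrix units `e i j` in `B(H)` whose diagonal part `e i i` is a maximal
sequence of pairwise orthogonal minimal projections. -/
structure MatrixUnits (H : Type*) [NormedAddCommGroup H] [InnerProductSpace ℂ H]
    [CompleteSpace H] where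
  /-- the matrix units -/
  e : ℕ → ℕ → (H →L[ℂ] H)
  star_e : ∀ i j, star (e i j) = e j i
  mul_e : ∀ i j l, e i j * e j l = e i l
  mul_e_of_ne : ∀ i j k l, j ≠ k → e i j * e k l = 0
  minimal : ∀ i, IsMinimalProjection (e i i)
  maximal : ¬ ∃ q : H →L[ℂ] H, IsMinimalProjection q ∧ ∀ i, q * e i i = 0

namespace MatrixUnits

variable {H : Type*} [NormedAddCommGroup H] [InnerProductSpace ℂ H] [CompleteSpace H]

/-- `s i j = e i j - e j i` as a skew-adjoint operator. -/
def s (u : MatrixUnits H) (i j : ℕ) : Bsk H :=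
  ⟨u.e i j - u.e j i, show star (u.e i j - u.e j i) = -(u.e i j - u.e j i) by
    rw [star_sub, u.star_e, u.star_e, neg_sub]⟩

/-- `I • e i i` as a skew-adjoint operator, where `I` is the imaginary unit. -/
def Ie (u : MatrixUnits H) (i : ℕ) : Bsk H :=
  ⟨Complex.I • u.e i i, show star (Complex.I • u.e i i) = -(Complex.I • u.e i i) by
    rw [star_smul, u.star_e, ← neg_smul]; simp⟩

end MatrixUnits

section LieDerivations

variable {R A : Type*} [CommRing R] [LieRing A] [LieAlgebra R A]

/-- A map `Δ` (not assumed additive or linear) is a 2-local derivation if it agrees on any two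
elements with some derivation. -/
def IsTwoLocalDerivation (R : Type*) {A : Type*} [CommRing R] [LieRing A] [LieAlgebra R A]
    (Δ : A → A) : Prop :=
  ∀ x y : A, ∃ D : LieDerivation R A A, Δ x = D x ∧ Δ y = D y

/-- A spatial derivation on the Lie subalgebra `B` of `A`: a derivation of `B` implemented by an
element of `A`. -/
def IsSpatialDerivation (B : LieSubalgebra R A) (Δ : B → B) : Prop :=
  (∃ D : LieDerivation R B B, ∀ x, Δ x = D x) ∧
    ∃ a : A, ∀ x : B, (Δ x : A) = ⁅a, (x : A)⁆

/-- A 2-local spatial derivation on the Lie subalgebra `B` of `A` implemented by elements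
of `A`. -/
def IsTwoLocalSpatialDerivation (B : LieSubalgebra R A) (Δ : B → B) : Prop :=
  IsTwoLocalDerivation R Δ ∧
    ∀ x y : B, ∃ a : A, (Δ x : A) = ⁅a, (x : A)⁆ ∧ (Δ y : A) = ⁅a, (y : A)⁆

end LieDerivations

end

/-!
Subtracting one implementing element from `Δ`, we may assume that it kills both `x_o` and `I e₀₀`;
evaluating at a point of `Ω`, we get a map `δ` into `B(H)`, implemented on pairs, and have to show
`δ = 0`. Let `T` be a linear functional on `B(H)` extending the trace of finite-rank operators.
Cycling under `T` gives `T (δ x * y) = -T (x * δ y)` for finite-rank `y`. Hence `x` is killed by `δ`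
if and only if it lies in the polar of `{δ y | y finite rank}`, which is a complex subspace although
`δ` is not assumed additive. An element `a` with `⁅a, x⁆ = 0` also commutes with `x²`, so the polar
is closed under Jordan products of elements killed by `δ`.

The Jordan product of `x_o` with `I eₙₙ` involves only `s k (k + 1)` for `k ≤ n`, so by induction
every `I eₙₙ` and every `s n (n + 1)` lies in the polar. Elements commuting with `s n (n + 1)` leave
the corner of `eₙₙ + eₙ₊₁ₙ₊₁` invariant; this puts `I (eₙₙ₊₁ + eₙ₊₁ₙ)` in the polar, and Jordan
products yield all other matrix units. Thus `T (δ x * y) = 0` for all finitary `y`, and `δ x = 0`.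
-/

section

attribute [local instance] LieRing.ofAssociativeRing

section TwoLocal

/-- `δ` is implemented along `π` by inner derivations of `𝔤`, with an implementing element that may
depend on the pair of arguments. The map `π` allows for algebras of maps evaluated at a point. -/
def IsTwoLocalInner {V 𝔤 : Type*} [LieRing 𝔤] (π δ : V → 𝔤) : Prop :=
  ∀ x y, ∃ a : 𝔤, δ x = ⁅a, π x⁆ ∧ δ y = ⁅a, π y⁆

theorem IsTwoLocalInner.sub_lie {V 𝔤 : Type*} [LieRing 𝔤] {π δ : V → 𝔤}
    (hδ : IsTwoLocalInner π δ) (a : 𝔤) : IsTwoLocalInner π fun x => δ x - ⁅a, π x⁆ := by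
  intro x y
  obtain ⟨b, hx, hy⟩ := hδ x y
  exact ⟨b - a, by simp only [hx, _root_.sub_lie], by simp only [hy, _root_.sub_lie]⟩

theorem IsTwoLocalInner.comp {V 𝔤 𝔥 : Type*} [LieRing 𝔤] [LieRing 𝔥] {π δ : V → 𝔤}
    (hδ : IsTwoLocalInner π δ) {f : 𝔤 → 𝔥} (hf : ∀ a b, f ⁅a, b⁆ = ⁅f a, f b⁆) :
    IsTwoLocalInner (f ∘ π) (f ∘ δ) := by
  intro x y
  obtain ⟨a, hx, hy⟩ := hδ x y
  exact ⟨f a, (congrArg f hx).trans (hf _ _), (congrArg f hy).trans (hf _ _)⟩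

theorem isSpatialDerivation_of_forall_eq_lie {R A : Type*} [CommRing R] [LieRing A]
    [LieAlgebra R A] {B : LieSubalgebra R A} {Δ : B → B} (a : A)
    (h : ∀ x : B, (Δ x : A) = ⁅a, (x : A)⁆) : IsSpatialDerivation B Δ := by
  refine ⟨⟨⟨⟨⟨Δ, fun x y => ?_⟩, fun r x => ?_⟩, fun x y => ?_⟩, fun x => rfl⟩, a, h⟩
  · exact Subtype.ext (by simp [h])
  · exact Subtype.ext (by simp [h])
  · apply Subtype.ext
    change (Δ ⁅x, y⁆ : A) = ⁅(x : A), (Δ y : A)⁆ - ⁅(y : A), (Δ x : A)⁆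
    rw [h, h, h, LieSubalgebra.coe_bracket, leibniz_lie, ← lie_skew ⁅a, (x : A)⁆]
    abel

end TwoLocal

section TracePolar

variable {K A M V : Type*} [CommRing K] [Ring A] [Algebra K A] [AddCommGroup M] [Module K M]
  {T : A →ₗ[K] M}

/-- The elements around which the factors of a product may be cycled under `T`. If `T` is a linear
extension of the trace to all bounded operators, these include the finite-rank operators. -/
def tracialElements (T : A →ₗ[K] M) : Submodule K A where
  carrier := {y | ∀ b c, T (b * y * c) = T (c * b * y)}
  add_mem' hy hz b c := by simp only [mul_add, add_mul, map_add, hy b c, hz b c]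
  zero_mem' b c := by simp only [mul_zero, zero_mul]
  smul_mem' r y hy b c := by simp only [mul_smul_comm, smul_mul_assoc, map_smul, hy b c]

theorem map_lie_mul_of_mem_tracialElements {y : A} (hy : y ∈ tracialElements T) (a x : A) :
    T (⁅a, x⁆ * y) = -T (x * ⁅a, y⁆) := by
  have hcycle : T (x * y * a) = T (a * x * y) := hy x a
  simp only [Ring.lie_def, sub_mul, mul_sub, map_sub, ← mul_assoc, hcycle]
  abel

/-- The tracial elements in the range of `π` detect elements of `A` through `T`. -/
def SeparatedByRange (T : A →ₗ[K] M) (π : V → A) : Prop :=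
  ∀ w, (∀ y, π y ∈ tracialElements T → T (w * π y) = 0) → w = 0

/-- The polar, under the pairing `(w, v) ↦ T (w * v)`, of the values of `δ` at the tracial elements
of the range of `π`. -/
def tracePolar (T : A →ₗ[K] M) (π δ : V → A) : Submodule K A where
  carrier := {w | ∀ y, π y ∈ tracialElements T → T (w * δ y) = 0}
  add_mem' hw hz y hy := by simp only [add_mul, map_add, hw y hy, hz y hy, add_zero]
  zero_mem' y _ := by simp only [zero_mul, map_zero]
  smul_mem' r w hw y hy := by simp only [smul_mul_assoc, map_smul, hw y hy, smul_zero]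

/-- `O` is closed under the Jordan product of its elements that lie in `S`. -/
def IsJordanClosedOn (S : Set A) (O : Submodule K A) : Prop :=
  ∀ ⦃z⦄, z ∈ S → z ∈ O → ∀ ⦃z'⦄, z' ∈ S → z' ∈ O → z * z' + z' * z ∈ O

namespace IsTwoLocalInner

theorem map_mul_eq_neg {π δ : V → A} (hδ : IsTwoLocalInner π δ) (x : V) {y : V}
    (hy : π y ∈ tracialElements T) : T (δ x * π y) = -T (π x * δ y) := by
  obtain ⟨a, hx, hya⟩ := hδ x y
  rw [hx, hya, map_lie_mul_of_mem_tracialElements hy]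

theorem mem_tracePolar_iff {π δ : V → A} (hδ : IsTwoLocalInner π δ) (hT : SeparatedByRange T π)
    {x : V} : π x ∈ tracePolar T π δ ↔ δ x = 0 := by
  constructor
  · intro hx
    refine hT _ fun y hy => ?_
    rw [hδ.map_mul_eq_neg x hy, hx y hy, neg_zero]
  · intro hx y hy
    rw [← neg_eq_zero, ← hδ.map_mul_eq_neg x hy, hx, zero_mul, map_zero]

theorem map_mul_eq_zero {π δ : V → A} (hδ : IsTwoLocalInner π δ) (x : V) {y : V}
    (hy : π y ∈ tracialElements T) (hδy : δ y = 0) : T (δ x * π y) = 0 := by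
  rw [hδ.map_mul_eq_neg x hy, hδy, mul_zero, map_zero, neg_zero]

theorem mul_self_mem_tracePolar {π δ : V → A} (hδ : IsTwoLocalInner π δ) {x : V} (hx : δ x = 0) :
    π x * π x ∈ tracePolar T π δ := by
  intro y hy
  obtain ⟨a, hxa, hya⟩ := hδ x y
  have hcomm : Commute a (π x) := sub_eq_zero.mp (hxa.symm.trans hx)
  have hcomm_sq : ⁅a, π x * π x⁆ = 0 := sub_eq_zero.mpr (hcomm.mul_right hcomm)
  rw [hya, ← neg_eq_zero, ← map_lie_mul_of_mem_tracialElements hy, hcomm_sq, zero_mul, map_zero]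

theorem isJordanClosedOn_tracePolar [AddMonoid V] {π : V →+ A} {δ : V → A}
    (hδ : IsTwoLocalInner π δ) (hT : SeparatedByRange T π) :
    IsJordanClosedOn (Set.range π) (tracePolar T π δ) := by
  rintro _ ⟨x, rfl⟩ hx _ ⟨y, rfl⟩ hy
  have hsq : ∀ {z : V}, π z ∈ tracePolar T π δ → π z * π z ∈ tracePolar T π δ := fun hz =>
    hδ.mul_self_mem_tracePolar ((hδ.mem_tracePolar_iff hT).mp hz)
  have hadd : π (x + y) ∈ tracePolar T π δ := by
    rw [map_add]
    exact add_mem hx hy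
  have hpolar : π x * π y + π y * π x =
      π (x + y) * π (x + y) - π x * π x - π y * π y := by
    rw [map_add]
    noncomm_ring
  rw [hpolar]
  exact sub_mem (sub_mem (hsq hadd) (hsq hx)) (hsq hy)

end IsTwoLocalInner

end TracePolar

section RankOne

open InnerProductSpace

variable {H : Type*} [NormedAddCommGroup H] [InnerProductSpace ℂ H] [CompleteSpace H]

theorem mul_rankOne {𝕜 E : Type*} [RCLike 𝕜] [NormedAddCommGroup E] [InnerProductSpace 𝕜 E]
    (a : E →L[𝕜] E) (p q : E) : a * rankOne 𝕜 p q = rankOne 𝕜 (a p) q :=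
  comp_rankOne p q a

theorem rankOne_mul {𝕜 E : Type*} [RCLike 𝕜] [NormedAddCommGroup E] [InnerProductSpace 𝕜 E]
    [CompleteSpace E] (a : E →L[𝕜] E) (p q : E) :
    rankOne 𝕜 p q * a = rankOne 𝕜 p (star a q) :=
  rankOne_comp p q a

/-- `T` extends the trace of finite-rank operators to all bounded operators. Only linearity is
required, so such extensions exist, but they are neither continuous nor unique. -/
def ExtendsTrace (T : (H →L[ℂ] H) →ₗ[ℂ] ℂ) : Prop :=
  ∀ p q : H, T (rankOne ℂ p q) = inner ℂ q p

theorem exists_extendsTrace (H : Type*) [NormedAddCommGroup H] [InnerProductSpace ℂ H]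
    [CompleteSpace H] : ∃ T : (H →L[ℂ] H) →ₗ[ℂ] ℂ, ExtendsTrace T := by
  obtain ⟨ι, b, -⟩ := exists_hilbertBasis ℂ H
  let S : Submodule ℂ (H →L[ℂ] H) :=
    { carrier := {w | Summable fun k => inner ℂ (b k) (w (b k))}
      zero_mem' := by simp
      add_mem' := fun hx hy => by simpa [inner_add_right] using Summable.add hx hy
      smul_mem' := fun c x hx => by simpa [inner_smul_right] using Summable.mul_left c hx }
  let diagonalSum : S →ₗ[ℂ] ℂ :=
    { toFun := fun w => ∑' k, inner ℂ (b k) ((w : H →L[ℂ] H) (b k))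
      map_add' := fun x y => by
        rw [← Summable.tsum_add x.2 y.2]
        simp
      map_smul' := fun c x => by
        rw [RingHom.id_apply, smul_eq_mul, ← tsum_mul_left]
        simp }
  obtain ⟨T, hT⟩ := LinearMap.exists_extend diagonalSum
  refine ⟨T, fun p q => ?_⟩
  have hsum : HasSum (fun k => inner ℂ (b k) (rankOne ℂ p q (b k))) (inner ℂ q p) := by
    simpa only [rankOne_apply, inner_smul_right] using b.hasSum_inner_mul_inner q p
  have hmem : rankOne ℂ p q ∈ S := hsum.summable
  calc T (rankOne ℂ p q) = diagonalSum ⟨rankOne ℂ p q, hmem⟩ := by rw [← hT]; rfl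
    _ = inner ℂ q p := hsum.tsum_eq

theorem ExtendsTrace.rankOne_mem_tracialElements {T : (H →L[ℂ] H) →ₗ[ℂ] ℂ} (hT : ExtendsTrace T)
    (p q : H) : rankOne ℂ p q ∈ tracialElements T := by
  intro b c
  rw [mul_rankOne, rankOne_mul, hT, mul_rankOne, hT, mul_apply_eq_comp,
    ContinuousLinearMap.star_eq_adjoint, ContinuousLinearMap.adjoint_inner_left]

theorem IsMinimalProjection.exists_eq_rankOne {p : H →L[ℂ] H} (hp : IsMinimalProjection p) :
    ∃ v : H, ‖v‖ = 1 ∧ p = rankOne ℂ v v := by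
  obtain ⟨hproj, hne, hmin⟩ := hp
  obtain ⟨ξ, hξ⟩ : ∃ ξ, p ξ ≠ 0 := by
    by_contra! h
    exact hne (ContinuousLinearMap.ext h)
  let v := ((‖p ξ‖ : ℂ)⁻¹) • p ξ
  have hv : ‖v‖ = 1 := norm_smul_inv_norm hξ
  have hpv : p v = v := by
    have hpp : p (p ξ) = p ξ := congrArg (fun f : H →L[ℂ] H => f ξ) hproj.isIdempotentElem.eq
    rw [map_smul, hpp]
  have hle : rankOne ℂ v v * p = rankOne ℂ v v := by
    rw [rankOne_mul, hproj.isSelfAdjoint.star_eq, hpv]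
  have hv₀ : v ≠ 0 := norm_ne_zero_iff.mp (hv.trans_ne one_ne_zero)
  exact ⟨v, hv, ((hmin _ (isStarProjection_rankOne_self hv) hle).resolve_left
    (rankOne_ne_zero hv₀ hv₀)).symm⟩

theorem isMinimalProjection_rankOne_self {v : H} (hv : ‖v‖ = 1) :
    IsMinimalProjection (rankOne ℂ v v) := by
  have hv₀ : v ≠ 0 := norm_ne_zero_iff.mp (hv.trans_ne one_ne_zero)
  have hproj : IsStarProjection (rankOne ℂ v v) := isStarProjection_rankOne_self hv
  refine ⟨hproj, rankOne_ne_zero hv₀ hv₀, fun q hq hle => ?_⟩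
  have hle' : rankOne ℂ v v * q = q := by
    simpa only [star_mul, hq.isSelfAdjoint.star_eq, hproj.isSelfAdjoint.star_eq]
      using congrArg star hle
  obtain ⟨c, hc⟩ : ∃ c : ℂ, q = c • rankOne ℂ v v := by
    refine ⟨inner ℂ v (q v), ?_⟩
    rw [← hle, mul_rankOne, ← hle']
    simp [hv]
  have hcc : c * c = c := by
    refine smul_left_injective ℂ (rankOne_ne_zero (𝕜 := ℂ) hv₀ hv₀) ?_
    simpa [hc, hproj.isIdempotentElem.eq, smul_smul] using hq.isIdempotentElem.eq
  rcases eq_or_ne c 0 with rfl | h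
  · exact Or.inl (by rw [hc, zero_smul])
  · exact Or.inr (by rw [hc, mul_left_cancel₀ h (hcc.trans (mul_one c).symm), one_smul])

end RankOne

namespace MatrixUnits

open InnerProductSpace

variable {H : Type*} [NormedAddCommGroup H] [InnerProductSpace ℂ H] [CompleteSpace H]

theorem exists_hilbertBasis_eq_rankOne (u : MatrixUnits H) :
    ∃ b : HilbertBasis ℕ ℂ H, ∀ i j, u.e i j = rankOne ℂ (b i) (b j) := by
  obtain ⟨v₀, hv₀, h₀⟩ := (u.minimal 0).exists_eq_rankOne
  let v : ℕ → H := fun i => u.e i 0 v₀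
  have he : ∀ i j, u.e i j = rankOne ℂ (v i) (v j) := by
    intro i j
    rw [← u.mul_e i 0 j, ← u.mul_e 0 0 j, h₀, rankOne_mul, mul_rankOne, u.star_e]
  have hv : Orthonormal ℂ v := by
    rw [orthonormal_iff_ite]
    intro i j
    have hinner : inner ℂ (v i) (v j) = inner ℂ v₀ ((u.e 0 i * u.e j 0) v₀) := by
      rw [mul_apply_eq_comp, ← u.star_e i 0, ContinuousLinearMap.star_eq_adjoint,
        ContinuousLinearMap.adjoint_inner_right]
    rw [hinner]
    split_ifs with hij
    · rw [hij, u.mul_e, h₀]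
      simp [hv₀]
    · rw [u.mul_e_of_ne _ _ _ _ hij, zero_apply, inner_zero_right]
  have htotal : (Submodule.span ℂ (Set.range v))ᗮ = ⊥ := by
    refine (Submodule.eq_bot_iff _).mpr fun ξ hξ => ?_
    by_contra hne
    refine u.maximal ⟨_, isMinimalProjection_rankOne_self (norm_smul_inv_norm (𝕜 := ℂ) hne),
      fun i => ?_⟩
    have horth : inner ℂ ξ (v i) = 0 :=
      Submodule.inner_left_of_mem_orthogonal (Submodule.subset_span (Set.mem_range_self i)) hξ
    rw [he, mul_rankOne, rankOne_apply, inner_smul_left, horth]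
    simp
  refine ⟨HilbertBasis.mkOfOrthogonalEqBot hv htotal, fun i j => ?_⟩
  rw [HilbertBasis.coe_mkOfOrthogonalEqBot, he]

variable (u : MatrixUnits H) {T : (H →L[ℂ] H) →ₗ[ℂ] ℂ}

theorem e_mem_tracialElements (hT : ExtendsTrace T) (i j : ℕ) :
    u.e i j ∈ tracialElements T := by
  obtain ⟨b, hb⟩ := u.exists_hilbertBasis_eq_rankOne
  exact hb i j ▸ hT.rankOne_mem_tracialElements _ _

theorem eq_zero_of_forall_trace_mul_e_eq_zero (hT : ExtendsTrace T) {w : H →L[ℂ] H}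
    (hw : ∀ i j, T (w * u.e i j) = 0) : w = 0 := by
  obtain ⟨b, hb⟩ := u.exists_hilbertBasis_eq_rankOne
  have hentry : ∀ i j, inner ℂ (b j) (w (b i)) = 0 := fun i j => by
    rw [← hT, ← mul_rankOne, ← hb, hw]
  refine ContinuousLinearMap.ext_on
    (Submodule.dense_iff_topologicalClosure_eq_top.mpr b.dense_span) ?_
  rintro _ ⟨i, rfl⟩
  refine b.repr.map_eq_zero_iff.mp (lp.ext (funext fun j => ?_))
  rw [b.repr_apply_apply, hentry]
  rfl

/-- The skew-adjoint operator `I (e i j + e j i)`. Together with the `s i j`, these span the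
finitary skew-adjoint matrices over `ℝ`; the diagonal ones are `Isymm i i = 2 Ie i`. -/
def Isymm (i j : ℕ) : Bsk H :=
  ⟨Complex.I • (u.e i j + u.e j i),
    show star (Complex.I • (u.e i j + u.e j i)) = -(Complex.I • (u.e i j + u.e j i)) by
      rw [star_smul, star_add, u.star_e, u.star_e, add_comm (u.e j i), ← neg_smul]; simp⟩

theorem coe_s (i j : ℕ) : (u.s i j : H →L[ℂ] H) = u.e i j - u.e j i := rfl

theorem coe_Isymm (i j : ℕ) :
    (u.Isymm i j : H →L[ℂ] H) = Complex.I • (u.e i j + u.e j i) := rfl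

theorem s_swap (i j : ℕ) : u.s j i = -u.s i j :=
  Subtype.ext (neg_sub (u.e i j) (u.e j i)).symm

theorem s_self (i : ℕ) : u.s i i = 0 :=
  Subtype.ext (sub_self (u.e i i))

theorem Isymm_swap (i j : ℕ) : u.Isymm j i = u.Isymm i j :=
  Subtype.ext (by rw [coe_Isymm, coe_Isymm, add_comm])

theorem Isymm_self (i : ℕ) : u.Isymm i i = u.Ie i + u.Ie i :=
  Subtype.ext (smul_add Complex.I (u.e i i) (u.e i i))

theorem e_mul_e (i j k l : ℕ) : u.e i j * u.e k l = if j = k then u.e i l else 0 := by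
  split_ifs with hjk
  · rw [hjk, u.mul_e]
  · exact u.mul_e_of_ne _ _ _ _ hjk

theorem lie_Ie_s {i j : ℕ} (hij : i ≠ j) : ⁅u.Ie i, u.s i j⁆ = u.Isymm i j := by
  apply Subtype.ext
  change (Complex.I • u.e i i) * (u.e i j - u.e j i) - (u.e i j - u.e j i) * (Complex.I • u.e i i) =
    Complex.I • (u.e i j + u.e j i)
  simp only [mul_sub, sub_mul, smul_mul_assoc, mul_smul_comm, u.e_mul_e, hij, hij.symm, if_true,
    if_false]
  module

theorem e_eq_smul_s_sub_smul_Isymm (i j : ℕ) :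
    u.e i j = (1 / 2 : ℂ) • (u.s i j : H →L[ℂ] H) -
      (Complex.I / 2) • (u.Isymm i j : H →L[ℂ] H) := by
  rw [coe_s, coe_Isymm, smul_smul, div_mul_eq_mul_div, Complex.I_mul_I]
  module

theorem map_mul_e_eq_zero {w : H →L[ℂ] H} {i j : ℕ} (hs : T (w * u.s i j) = 0)
    (hIsymm : T (w * u.Isymm i j) = 0) : T (w * u.e i j) = 0 := by
  rw [e_eq_smul_s_sub_smul_Isymm, mul_sub, mul_smul_comm, mul_smul_comm, map_sub, map_smul,
    map_smul, hs, hIsymm, smul_zero, smul_zero, sub_zero]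

theorem s_mem_tracialElements (hT : ExtendsTrace T) (i j : ℕ) :
    (u.s i j : H →L[ℂ] H) ∈ tracialElements T :=
  sub_mem (u.e_mem_tracialElements hT i j) (u.e_mem_tracialElements hT j i)

theorem Isymm_mem_tracialElements (hT : ExtendsTrace T) (i j : ℕ) :
    (u.Isymm i j : H →L[ℂ] H) ∈ tracialElements T :=
  Submodule.smul_mem _ _
    (add_mem (u.e_mem_tracialElements hT i j) (u.e_mem_tracialElements hT j i))

theorem separatedByRange (hT : ExtendsTrace T) {V : Type*} {π : V → H →L[ℂ] H}
    (hs : ∀ i j, (u.s i j : H →L[ℂ] H) ∈ Set.range π)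
    (hIsymm : ∀ i j, (u.Isymm i j : H →L[ℂ] H) ∈ Set.range π) : SeparatedByRange T π := by
  refine fun w hw => u.eq_zero_of_forall_trace_mul_e_eq_zero hT fun i j => ?_
  obtain ⟨x, hx⟩ := hs i j
  obtain ⟨y, hy⟩ := hIsymm i j
  refine u.map_mul_e_eq_zero ?_ ?_
  · exact hx ▸ hw x (hx ▸ u.s_mem_tracialElements hT i j)
  · exact hy ▸ hw y (hy ▸ u.Isymm_mem_tracialElements hT i j)

section Corner

variable {i j : ℕ}

theorem s_mul_s (hij : i ≠ j) :
    (u.s i j : H →L[ℂ] H) * u.s i j = -(u.e i i + u.e j j) := by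
  simp only [coe_s, mul_sub, sub_mul, u.e_mul_e, hij, hij.symm, if_true, if_false]
  abel

theorem eq_zero_of_corner (hT : ExtendsTrace T) {w : H →L[ℂ] H}
    (hleft : (u.e i i + u.e j j) * w = w) (hright : w * (u.e i i + u.e j j) = w)
    (hii : T (w * u.e i i) = 0) (hjj : T (w * u.e j j) = 0)
    (hij : T (w * u.e i j) = 0) (hji : T (w * u.e j i) = 0) : w = 0 := by
  have hrow : ∀ k l, k ≠ i → k ≠ j → T (w * u.e k l) = 0 := fun k l hki hkj => by
    rw [← hright, mul_assoc, add_mul, u.mul_e_of_ne _ _ _ _ hki.symm,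
      u.mul_e_of_ne _ _ _ _ hkj.symm, add_zero, mul_zero, map_zero]
  have hcol : ∀ k l, l ≠ i → l ≠ j → T (w * u.e k l) = 0 := fun k l hli hlj => by
    rw [← hleft, ← u.e_mem_tracialElements hT k l w, mul_assoc, mul_add,
      u.mul_e_of_ne _ _ _ _ hli, u.mul_e_of_ne _ _ _ _ hlj, add_zero, mul_zero, map_zero]
  refine u.eq_zero_of_forall_trace_mul_e_eq_zero hT fun k l => ?_
  by_cases hk : k = i ∨ k = j
  · by_cases hl : l = i ∨ l = j
    · rcases hk with rfl | rfl <;> rcases hl with rfl | rfl <;> assumption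
    · exact hcol k l (not_or.mp hl).1 (not_or.mp hl).2
  · exact hrow k l (not_or.mp hk).1 (not_or.mp hk).2

/- An implementing element commuting with `s i j` commutes with `(s i j)² = -(e i i + e j j)`, so
`δ y` lives in the corner of this projection, where it is orthogonal to all four matrix units. -/
theorem apply_eq_zero_of_eq_Isymm (hT : ExtendsTrace T) {V : Type*} {π δ : V → H →L[ℂ] H}
    (hδ : IsTwoLocalInner π δ) (hij : i ≠ j) {x y xi xj : V} (hx : π x = u.s i j)
    (hy : π y = u.Isymm i j) (hxi : π xi = u.Isymm i i) (hxj : π xj = u.Isymm j j)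
    (hδx : δ x = 0) (hδi : δ xi = 0) (hδj : δ xj = 0) : δ y = 0 := by
  have htr_s : T (δ y * u.s i j) = 0 :=
    hx ▸ hδ.map_mul_eq_zero y (hx ▸ u.s_mem_tracialElements hT i j) hδx
  have htr_Isymm : T (δ y * u.Isymm i j) = 0 := by
    have htr : π y ∈ tracialElements T := hy ▸ u.Isymm_mem_tracialElements hT i j
    have hanti : T (δ y * π y) = -T (π y * δ y) := hδ.map_mul_eq_neg y htr
    have hsymm : T (δ y * π y) = T (π y * δ y) := by
      simpa only [one_mul, mul_one] using (htr 1 (δ y)).symm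
    rw [← hy]
    linear_combination (hanti + hsymm) / 2
  have hdiag : ∀ k z, π z = u.Isymm k k → δ z = 0 → T (δ y * u.e k k) = 0 := fun k z hz hδz => by
    refine u.map_mul_e_eq_zero (by simp [s_self]) ?_
    exact hz ▸ hδ.map_mul_eq_zero y (hz ▸ u.Isymm_mem_tracialElements hT k k) hδz
  obtain ⟨a, hxa, hya⟩ := hδ x y
  have hcomm : Commute a (u.s i j : H →L[ℂ] H) := hx ▸ sub_eq_zero.mp (hxa.symm.trans hδx)
  have hcommq : Commute a (u.e i i + u.e j j) := by
    simpa only [u.s_mul_s hij, neg_neg] using (hcomm.mul_right hcomm).neg_right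
  have hleft : (u.e i i + u.e j j) * π y = π y := by
    simp [hy, coe_Isymm, mul_add, add_mul, u.e_mul_e, hij, hij.symm, add_comm]
  have hright : π y * (u.e i i + u.e j j) = π y := by
    simp [hy, coe_Isymm, mul_add, add_mul, u.e_mul_e, hij, hij.symm, add_comm]
  refine u.eq_zero_of_corner hT ?_ ?_ (hdiag i xi hxi hδi) (hdiag j xj hxj hδj)
    (u.map_mul_e_eq_zero htr_s htr_Isymm) (u.map_mul_e_eq_zero ?_ ?_)
  · rw [hya, Ring.lie_def, mul_sub, ← mul_assoc, ← hcommq.eq, mul_assoc, ← mul_assoc _ (π y), hleft]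
  · rw [hya, Ring.lie_def, sub_mul, mul_assoc a, hright, mul_assoc (π y), hcommq.eq, ← mul_assoc,
      hright]
  · rw [s_swap, NegMemClass.coe_neg, mul_neg, map_neg, htr_s, neg_zero]
  · rw [Isymm_swap, htr_Isymm]

end Corner

section JordanPropagation

variable {i j k : ℕ}

theorem s_jordan_s (hij : i ≠ j) (hjk : j ≠ k) (hik : i ≠ k) :
    (u.s i j : H →L[ℂ] H) * u.s j k + u.s j k * (u.s i j : H →L[ℂ] H) =
      (-Complex.I) • (u.Isymm i k : H →L[ℂ] H) := by
  simp only [coe_s, coe_Isymm, mul_sub, sub_mul, u.e_mul_e, hij, hij.symm, hjk, hjk.symm, hik,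
    hik.symm, if_true, if_false, smul_smul, neg_mul, Complex.I_mul_I]
  module

theorem s_jordan_Isymm (hij : i ≠ j) (hjk : j ≠ k) (hik : i ≠ k) :
    (u.s i j : H →L[ℂ] H) * u.Isymm j k + u.Isymm j k * (u.s i j : H →L[ℂ] H) =
      Complex.I • (u.s i k : H →L[ℂ] H) := by
  simp only [coe_s, coe_Isymm, mul_add, add_mul, mul_sub, sub_mul, mul_smul_comm, smul_mul_assoc,
    u.e_mul_e, hij, hij.symm, hjk, hjk.symm, hik, hik.symm, if_true, if_false]
  module

theorem s_jordan_Isymm_self (hij : i ≠ j) :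
    (u.s i j : H →L[ℂ] H) * u.Isymm i i + u.Isymm i i * (u.s i j : H →L[ℂ] H) =
      (2 * Complex.I) • (u.s i j : H →L[ℂ] H) := by
  simp only [coe_s, coe_Isymm, mul_add, add_mul, mul_sub, sub_mul, mul_smul_comm, smul_mul_assoc,
    u.e_mul_e, hij, hij.symm, if_true, if_false]
  module

theorem jordan_Isymm_self_of_hasSum {lam : ℕ → ℂ} {X : H →L[ℂ] H}
    (hX : HasSum (fun k => lam k • (u.s k (k + 1) : H →L[ℂ] H)) X) (n : ℕ) :
    X * u.Isymm n n + u.Isymm n n * X = ∑ k ∈ Finset.range (n + 1), lam k •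
      ((u.s k (k + 1) : H →L[ℂ] H) * u.Isymm n n + u.Isymm n n * (u.s k (k + 1) : H →L[ℂ] H)) := by
  refine ((hX.mul_right _).add (hX.mul_left _)).unique ?_
  simp only [smul_mul_assoc, mul_smul_comm, ← smul_add]
  refine hasSum_sum_of_ne_finset_zero fun k hk => ?_
  have hnk : n < k := by simpa using hk
  simp [coe_s, coe_Isymm, mul_add, add_mul, mul_sub, sub_mul, u.e_mul_e, hnk.ne, hnk.ne',
    (hnk.trans k.lt_succ_self).ne, (hnk.trans k.lt_succ_self).ne']

variable {u} {S : Set (H →L[ℂ] H)} {O : Submodule ℂ (H →L[ℂ] H)}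

theorem Isymm_self_mem_of_s_mem (hO : IsJordanClosedOn S O) (hij : i ≠ j)
    (hsS : (u.s i j : H →L[ℂ] H) ∈ S) (hs : (u.s i j : H →L[ℂ] H) ∈ O)
    (hi : (u.Isymm i i : H →L[ℂ] H) ∈ O) : (u.Isymm j j : H →L[ℂ] H) ∈ O := by
  have hsq : (u.s i j : H →L[ℂ] H) * u.s i j + u.s i j * (u.s i j : H →L[ℂ] H) ∈ O :=
    hO hsS hs hsS hs
  have heq : (u.Isymm j j : H →L[ℂ] H) = (-Complex.I) •
      ((u.s i j : H →L[ℂ] H) * u.s i j + u.s i j * (u.s i j : H →L[ℂ] H)) - u.Isymm i i := by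
    rw [u.s_mul_s hij, coe_Isymm, coe_Isymm]
    module
  exact heq ▸ sub_mem (O.smul_mem _ hsq) hi

theorem Isymm_self_mem_and_s_succ_mem (hO : IsJordanClosedOn S O)
    (hsS : ∀ n, (u.s n (n + 1) : H →L[ℂ] H) ∈ S) (hIsymmS : ∀ n, (u.Isymm n n : H →L[ℂ] H) ∈ S)
    {lam : ℕ → ℂ} (hlam : ∀ n, lam n ≠ 0) {X : H →L[ℂ] H}
    (hX : HasSum (fun k => lam k • (u.s k (k + 1) : H →L[ℂ] H)) X) (hXS : X ∈ S) (hXO : X ∈ O)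
    (h0 : (u.Isymm 0 0 : H →L[ℂ] H) ∈ O) (n : ℕ) :
    (u.Isymm n n : H →L[ℂ] H) ∈ O ∧ (u.s n (n + 1) : H →L[ℂ] H) ∈ O := by
  induction n using Nat.strong_induction_on with
  | _ n ih =>
    have hn : (u.Isymm n n : H →L[ℂ] H) ∈ O := by
      rcases n with _ | m
      · exact h0
      · exact Isymm_self_mem_of_s_mem hO m.succ_ne_self.symm (hsS m) (ih m m.lt_succ_self).2
          (ih m m.lt_succ_self).1
    have hjordan := hO hXS hXO (hIsymmS n) hn
    rw [u.jordan_Isymm_self_of_hasSum hX, Finset.sum_range_succ,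
      u.s_jordan_Isymm_self n.succ_ne_self.symm, smul_smul] at hjordan
    have hlower := O.sum_mem (t := Finset.range n) fun k hk =>
      O.smul_mem (lam k) (hO (hsS k) (ih k (Finset.mem_range.mp hk)).2 (hIsymmS n) hn)
    have hcoef : lam n * (2 * Complex.I) ≠ 0 := by simp [hlam n]
    exact ⟨hn, (O.smul_mem_iff hcoef).mp ((O.add_mem_iff_right hlower).mp hjordan)⟩

theorem s_mem_and_Isymm_mem_of_lt (hO : IsJordanClosedOn S O)
    (hsS : ∀ i j, (u.s i j : H →L[ℂ] H) ∈ S) (hIsymmS : ∀ i j, (u.Isymm i j : H →L[ℂ] H) ∈ S)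
    (hs : ∀ n, (u.s n (n + 1) : H →L[ℂ] H) ∈ O) (hIsymm : ∀ n, (u.Isymm n (n + 1) : H →L[ℂ] H) ∈ O)
    (hij : i < j) : (u.s i j : H →L[ℂ] H) ∈ O ∧ (u.Isymm i j : H →L[ℂ] H) ∈ O := by
  induction j, Nat.succ_le_of_lt hij using Nat.le_induction with
  | base => exact ⟨hs i, hIsymm i⟩
  | succ k hik ih =>
    have hik : i < k := hik
    have hjordan_s := u.s_jordan_s hik.ne k.succ_ne_self.symm (hik.trans k.lt_succ_self).ne
    have hjordan_Isymm := u.s_jordan_Isymm hik.ne k.succ_ne_self.symm (hik.trans k.lt_succ_self).ne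
    have hsk := (ih hik).1
    have hIsymm_mem := hO (hsS i k) hsk (hsS k (k + 1)) (hs k)
    have hs_mem := hO (hsS i k) hsk (hIsymmS k (k + 1)) (hIsymm k)
    rw [hjordan_s, O.smul_mem_iff (neg_ne_zero.mpr Complex.I_ne_zero)] at hIsymm_mem
    rw [hjordan_Isymm, O.smul_mem_iff Complex.I_ne_zero] at hs_mem
    exact ⟨hs_mem, hIsymm_mem⟩

theorem s_mem_and_Isymm_mem (hdiag : ∀ n, (u.Isymm n n : H →L[ℂ] H) ∈ O)
    (hupper : ∀ i j, i < j → (u.s i j : H →L[ℂ] H) ∈ O ∧ (u.Isymm i j : H →L[ℂ] H) ∈ O)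
    (i j : ℕ) : (u.s i j : H →L[ℂ] H) ∈ O ∧ (u.Isymm i j : H →L[ℂ] H) ∈ O := by
  rcases lt_trichotomy i j with hij | rfl | hji
  · exact hupper i j hij
  · exact ⟨by simp [s_self], hdiag i⟩
  · rw [s_swap, Isymm_swap, NegMemClass.coe_neg, neg_mem_iff]
    exact hupper j i hji

end JordanPropagation

section Vanishing

variable {V : Type*} {δ : V → H →L[ℂ] H}

theorem Isymm_mem_tracePolar (hT : ExtendsTrace T) {π : V → H →L[ℂ] H}
    (hδ : IsTwoLocalInner π δ) (hsπ : ∀ i j, (u.s i j : H →L[ℂ] H) ∈ Set.range π)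
    (hIsymmπ : ∀ i j, (u.Isymm i j : H →L[ℂ] H) ∈ Set.range π) {i j : ℕ} (hij : i ≠ j)
    (hs : (u.s i j : H →L[ℂ] H) ∈ tracePolar T π δ)
    (hi : (u.Isymm i i : H →L[ℂ] H) ∈ tracePolar T π δ)
    (hj : (u.Isymm j j : H →L[ℂ] H) ∈ tracePolar T π δ) :
    (u.Isymm i j : H →L[ℂ] H) ∈ tracePolar T π δ := by
  have hpolar : ∀ x, π x ∈ tracePolar T π δ ↔ δ x = 0 := fun x =>
    hδ.mem_tracePolar_iff (u.separatedByRange hT hsπ hIsymmπ)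
  obtain ⟨x, hx⟩ := hsπ i j
  obtain ⟨y, hy⟩ := hIsymmπ i j
  obtain ⟨xi, hxi⟩ := hIsymmπ i i
  obtain ⟨xj, hxj⟩ := hIsymmπ j j
  rw [← hx, hpolar] at hs
  rw [← hxi, hpolar] at hi
  rw [← hxj, hpolar] at hj
  rw [← hy, hpolar]
  exact u.apply_eq_zero_of_eq_Isymm hT hδ hij hx hy hxi hxj hs hi hj

theorem eq_zero_of_forall_mem_tracePolar (hT : ExtendsTrace T) {π : V → H →L[ℂ] H}
    (hδ : IsTwoLocalInner π δ) (hsπ : ∀ i j, (u.s i j : H →L[ℂ] H) ∈ Set.range π)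
    (hIsymmπ : ∀ i j, (u.Isymm i j : H →L[ℂ] H) ∈ Set.range π)
    (hmem : ∀ i j, (u.s i j : H →L[ℂ] H) ∈ tracePolar T π δ ∧
      (u.Isymm i j : H →L[ℂ] H) ∈ tracePolar T π δ) (x : V) : δ x = 0 := by
  have horth : ∀ w ∈ Set.range π, w ∈ tracialElements T → w ∈ tracePolar T π δ →
      T (δ x * w) = 0 := by
    rintro _ ⟨y, rfl⟩ hy hyO
    exact hδ.map_mul_eq_zero x hy
      ((hδ.mem_tracePolar_iff (u.separatedByRange hT hsπ hIsymmπ)).mp hyO)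
  refine u.eq_zero_of_forall_trace_mul_e_eq_zero hT fun i j => u.map_mul_e_eq_zero ?_ ?_
  · exact horth _ (hsπ i j) (u.s_mem_tracialElements hT i j) (hmem i j).1
  · exact horth _ (hIsymmπ i j) (u.Isymm_mem_tracialElements hT i j) (hmem i j).2

theorem eq_zero_of_isTwoLocalInner [AddMonoid V] {π : V →+ H →L[ℂ] H}
    (hδ : IsTwoLocalInner π δ) (hsπ : ∀ i j, (u.s i j : H →L[ℂ] H) ∈ Set.range π)
    (hIsymmπ : ∀ i j, (u.Isymm i j : H →L[ℂ] H) ∈ Set.range π) {lam : ℕ → ℂ} (hlam : ∀ n, lam n ≠ 0)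
    {xo d : V} (hxo : HasSum (fun n => lam n • (u.s n (n + 1) : H →L[ℂ] H)) (π xo))
    (hd : π d = u.Ie 0) (hδxo : δ xo = 0) (hδd : δ d = 0) (x : V) : δ x = 0 := by
  obtain ⟨T, hT⟩ := exists_extendsTrace H
  have hsep : SeparatedByRange T π := u.separatedByRange hT hsπ hIsymmπ
  have hJ : IsJordanClosedOn (Set.range π) (tracePolar T π δ) :=
    hδ.isJordanClosedOn_tracePolar hsep
  have hxoO : π xo ∈ tracePolar T π δ := (hδ.mem_tracePolar_iff hsep).mpr hδxo
  have hdO : π d ∈ tracePolar T π δ := (hδ.mem_tracePolar_iff hsep).mpr hδd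
  have h0 : (u.Isymm 0 0 : H →L[ℂ] H) ∈ tracePolar T π δ := by
    rw [Isymm_self, AddMemClass.coe_add, ← hd]
    exact add_mem hdO hdO
  have hchain : ∀ n, (u.Isymm n n : H →L[ℂ] H) ∈ tracePolar T π δ ∧
      (u.s n (n + 1) : H →L[ℂ] H) ∈ tracePolar T π δ :=
    Isymm_self_mem_and_s_succ_mem hJ (fun n => hsπ n _) (fun n => hIsymmπ n n) hlam hxo ⟨xo, rfl⟩
      hxoO h0
  have hsucc : ∀ n, (u.Isymm n (n + 1) : H →L[ℂ] H) ∈ tracePolar T π δ := fun n =>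
    u.Isymm_mem_tracePolar hT hδ hsπ hIsymmπ n.succ_ne_self.symm (hchain n).2 (hchain n).1
      (hchain (n + 1)).1
  exact u.eq_zero_of_forall_mem_tracePolar hT hδ hsπ hIsymmπ (s_mem_and_Isymm_mem
    (fun n => (hchain n).1) fun i j => s_mem_and_Isymm_mem_of_lt hJ hsπ hIsymmπ
      (fun n => (hchain n).2) hsucc) x

end Vanishing

section ConstantMaps

variable {Ω : Type*} {L : LieSubalgebra ℝ (FunBsk Ω H)}

theorem const_s_mem (hs : ∀ i j, i ≠ j → (fun _ => u.s i j : FunBsk Ω H) ∈ L) (i j : ℕ) :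
    (fun _ => u.s i j : FunBsk Ω H) ∈ L := by
  rcases eq_or_ne i j with rfl | hij
  · rw [s_self]
    exact zero_mem L
  · exact hs i j hij

theorem const_Isymm_mem (hIe : ∀ i, (fun _ => u.Ie i : FunBsk Ω H) ∈ L)
    (hs : ∀ i j, i ≠ j → (fun _ => u.s i j : FunBsk Ω H) ∈ L) (i j : ℕ) :
    (fun _ => u.Isymm i j : FunBsk Ω H) ∈ L := by
  rcases eq_or_ne i j with rfl | hij
  · rw [Isymm_self]
    exact add_mem (hIe i) (hIe i)
  · rw [← u.lie_Ie_s hij]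
    exact L.lie_mem (hIe i) (hs i j hij)

end ConstantMaps

end MatrixUnits

theorem mainTheorem2_general {H : Type*} [NormedAddCommGroup H] [InnerProductSpace ℂ H]
    [CompleteSpace H] (u : MatrixUnits H) {Ω : Type*} {lam : Ω → ℕ → ℂ}
    (hlam : ∀ t n, lam t n ≠ 0) {xo : FunBsk Ω H}
    (hxo : ∀ t, HasSum (fun n => lam t n • (u.s n (n + 1) : H →L[ℂ] H)) (xo t : H →L[ℂ] H))
    {L : LieSubalgebra ℝ (FunBsk Ω H)} (hxoL : xo ∈ L)
    (hIe : ∀ i, (fun _ => u.Ie i : FunBsk Ω H) ∈ L)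
    (hs : ∀ i j, i ≠ j → (fun _ => u.s i j : FunBsk Ω H) ∈ L)
    {Δ : L → L} (hΔ : IsTwoLocalInner (fun x : L => (x : FunBsk Ω H)) fun x => (Δ x : FunBsk Ω H)) :
    IsSpatialDerivation L Δ := by
  obtain ⟨a, hxo_eq, hIe_eq⟩ := hΔ ⟨xo, hxoL⟩ ⟨fun _ => u.Ie 0, hIe 0⟩
  refine isSpatialDerivation_of_forall_eq_lie a fun x => funext fun t => ?_
  let evalAt : FunBsk Ω H → (H →L[ℂ] H) := fun g => g t
  let π : L →+ (H →L[ℂ] H) :=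
    { toFun := fun x => evalAt x
      map_zero' := rfl
      map_add' := fun _ _ => rfl }
  have hlocal : IsTwoLocalInner π fun x => evalAt (Δ x - ⁅a, (x : FunBsk Ω H)⁆) :=
    (hΔ.sub_lie a).comp (f := evalAt) fun _ _ => rfl
  have hzero : evalAt (Δ x - ⁅a, (x : FunBsk Ω H)⁆) = 0 :=
    u.eq_zero_of_isTwoLocalInner hlocal (fun i j => ⟨⟨_, u.const_s_mem hs i j⟩, rfl⟩)
      (fun i j => ⟨⟨_, u.const_Isymm_mem hIe hs i j⟩, rfl⟩) (hlam t) (xo := ⟨xo, hxoL⟩) (hxo t)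
      (d := ⟨_, hIe 0⟩) rfl (congrArg evalAt (sub_eq_zero.mpr hxo_eq))
      (congrArg evalAt (sub_eq_zero.mpr hIe_eq)) x
  exact Subtype.ext (sub_eq_zero.mp hzero)

end

theorem mainTheorem2 {H : Type*} [NormedAddCommGroup H] [InnerProductSpace ℂ H] [CompleteSpace H]
    [TopologicalSpace.SeparableSpace H] (hH : ¬ FiniteDimensional ℂ H)
    (u : MatrixUnits H) {Ω : Type*}
    (lam : ℕ → ℂ) (hlam : ∀ n, lam n ≠ 0) (hlam_sum : Summable fun n => ‖lam n‖ ^ 2)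
    (xo : FunBsk Ω H)
    (hxo : ∀ t, HasSum (fun n => lam n • (u.s n (n + 1) : H →L[ℂ] H)) (xo t : H →L[ℂ] H))
    (L : LieSubalgebra ℝ (FunBsk Ω H)) (hxoL : xo ∈ L)
    (hIe : ∀ i, (fun _ => u.Ie i : FunBsk Ω H) ∈ L)
    (hs : ∀ i j, i ≠ j → (fun _ => u.s i j : FunBsk Ω H) ∈ L)
    (Δ : L → L) (hΔ : IsTwoLocalSpatialDerivation L Δ) :
    IsSpatialDerivation L Δ :=
  mainTheorem2_general u (fun _ => hlam) hxo hxoL hIe hs hΔ.2
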